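/- **Reeh–Schlieder in time.** Let $\mu$ be a tempered positive Borel measure on $\mathbb{R}$ with $\mu((-\infty,0))=0$ (the spectral measure $d\mu(\omega)=\Theta(\omega)\rho(\omega^2)\,d\omega$ of a generalized free field in $0+1$ dimensions). For a Schwartz function $f$ of time put $\hat f(\omega)=\int e^{i\omega t}f(t)\,dt$ and let $|f\rangle\in L^2(\mathbb{R},\mu)$ be the class of $\hat f$, so that $\langle f|g\rangle=\int \overline{\hat f}\,\hat g\,d\mu$. Let $W(f)$ be the Weyl operators, $W(f)W(g)=e^{-i\,\mathrm{Im}\langle f|g\rangle}W(f+g)$, $W(f)^*=W(-f)$ (depending only on $|f\rangle$), and for an open interval $J\subseteq\mathbb{R}$ let $\mathcal{B}_J$ be the C*-algebra generated by all $W(f)$ with $f$ supported in $J$, the norm being the C*-norm of the Weyl algebra. The test functions are either all real-valued or all complex-valued Schwartz functions; the result holds for either choice. Let $\pi$ be an irreducible representation of $\mathcal{B}_{(-\infty,\infty)}$ on a Hilbert space $\mathcal{H}$ such that $f\mapsto\pi(W(f))x$ is continuous in the Schwartz topology for every $x\in\mathcal{H}$, and let $t\mapsto e^{iHt}$ be a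 strongly continuous one-parameter unitary group on $\mathcal{H}$, with $H$ bounded from below, that implements time translations: $e^{iHt}\pi(W(f))e^{-iHt}=\pi(W(f(\cdot-t)))$. Let $\Psi\in\mathcal{H}$ be a unit vector such that $t\mapsto e^{iHt}\Psi$ extends to an entire function $\mathbb{C}\to\mathcal{H}$. Then for every finite time band $I=(t_1,t_2)$, $t_1<t_2$, the set $\{\pi(A)\Psi : A\in\mathcal{B}_I\}$ is dense in $\mathcal{H}$. -/

import Mathlib

open MeasureTheory Complex FourierTransform
open scoped SchwartzMap InnerProductSpace ENNReal

noncomputable section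

namespace GFF

/-! ### The Weyl (CCR) algebra -/

section Weyl

variable {V : Type*} [NormedAddCommGroup V] [InnerProductSpace ℂ V]

/-- The phase `e^{-i Im⟨h|g⟩}` of the Weyl relations. -/
def phase (h g : V) : ℂ := exp (-(I * ((⟪h, g⟫_ℂ).im : ℂ)))

lemma norm_phase (h g : V) : ‖phase h g‖ = 1 := by
  have : phase h g = exp (((-(⟪h, g⟫_ℂ).im : ℝ) : ℂ) * I) := by
    unfold phase; congr 1; push_cast; ring
  rw [this, norm_exp_ofReal_mul_I]

lemma phase_self (h : V) : phase h h = 1 := by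
  have : (⟪h, h⟫_ℂ).im = 0 := inner_self_im (𝕜 := ℂ) h
  rw [phase, this]
  simp

/-- The Hilbert space `ℓ²(V)` of the regular representation of the Weyl algebra over `V`
(`V` taken as a discrete group). -/
abbrev RegularSpace (V : Type*) : Type _ := lp (fun _ : V => ℂ) 2

lemma summable_weyl (h : V) (ξ : RegularSpace V) :
    Summable fun g : V => ‖phase h g * ξ (g - h)‖ ^ (2 : ℝ≥0∞).toReal := by
  have h1 : Summable fun g : V => ‖ξ g‖ ^ (2 : ℝ≥0∞).toReal :=
    (memℓp_gen_iff (by norm_num)).1 (lp.memℓp ξ)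
  refine ((Equiv.subRight h).summable_iff.2 h1).congr fun g => ?_
  simp [norm_phase]

/-- The Weyl operator `W(h)` in the regular representation on `ℓ²(V)`:
`W(h) δ_g = e^{-i Im⟨h|g⟩} δ_{g+h}`. -/
def weylIsometry (h : V) : RegularSpace V →ₗᵢ[ℂ] RegularSpace V where
  toFun ξ := ⟨fun g => phase h g * ξ (g - h), memℓp_gen (summable_weyl h ξ)⟩
  map_add' ξ η := by
    ext g
    exact mul_add (phase h g) (ξ (g - h)) (η (g - h))
  map_smul' c ξ := by
    ext g
    exact mul_left_comm (phase h g) c (ξ (g - h))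
  norm_map' ξ := by
    simp only [LinearMap.coe_mk, AddHom.coe_mk]
    rw [lp.norm_eq_tsum_rpow (by norm_num), lp.norm_eq_tsum_rpow (by norm_num)]
    congr 1
    simpa [norm_phase] using
      (Equiv.subRight h).tsum_eq fun g : V => ‖ξ g‖ ^ (2 : ℝ≥0∞).toReal

/-- The Weyl operator `W(h)` as a bounded operator on `ℓ²(V)`. -/
def weyl (h : V) : RegularSpace V →L[ℂ] RegularSpace V :=
  (weylIsometry h).toContinuousLinearMap

lemma weyl_apply (h : V) (ξ : RegularSpace V) (g : V) :
    weyl h ξ g = phase h g * ξ (g - h) := rfl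

lemma weyl_zero : weyl (0 : V) = 1 := by
  ext ξ g
  simp [weyl_apply, phase]

/-- The Weyl relations `W(h) W(k) = e^{-i Im⟨h|k⟩} W(h + k)`. -/
lemma weyl_mul (h k : V) : weyl h * weyl k = phase h k • weyl (h + k) := by
  ext ξ g
  have e : phase h g * phase k (g - h) = phase h k * phase (h + k) g := by
    have h2 : (⟪k, h⟫_ℂ).im = -(⟪h, k⟫_ℂ).im := inner_im_symm (𝕜 := ℂ) k h
    simp only [phase, ← Complex.exp_add, inner_sub_right, inner_add_left, Complex.sub_im,
      Complex.add_im, h2]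
    congr 1
    push_cast
    ring
  simp only [mul_apply_eq_comp, weyl_apply, smul_apply,
    lp.coeFn_smul, Pi.smul_apply, smul_eq_mul]
  rw [← mul_assoc, e, mul_assoc, sub_sub]

/-- `W(h)* = W(-h)`. -/
lemma star_weyl (h : V) : star (weyl h) = weyl (-h) := by
  have h1 : star (weyl h) * weyl h = 1 :=
    (ContinuousLinearMap.norm_map_iff_adjoint_comp_self (weyl h)).1
      fun x => (weylIsometry h).norm_map x
  have h2 : weyl h * weyl (-h) = 1 := by
    have h3 : phase h (-h) = 1 := by
      have : (⟪h, h⟫_ℂ).im = 0 := inner_self_im (𝕜 := ℂ) h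
      rw [phase, inner_neg_right, Complex.neg_im, this]
      simp
    rw [weyl_mul, h3, one_smul, add_neg_cancel, weyl_zero]
  calc star (weyl h) = star (weyl h) * (weyl h * weyl (-h)) := by rw [h2, mul_one]
    _ = weyl (-h) := by rw [← mul_assoc, h1, one_mul]

end Weyl

/-! ### The one-particle space and the time-band algebras -/

section TimeBand

variable {𝕜 : Type*} [RCLike 𝕜]

/-- The Fourier transform `f̂(ω) = ∫ e^{iωt} f(t) dt` of a real or complex Schwartz function of
time, as a Schwartz function of the frequency `ω`. -/
def hat (f : 𝓢(ℝ, 𝕜)) : 𝓢(ℝ, ℂ) :=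
  SchwartzMap.compCLMOfContinuousLinearEquiv ℂ
    (ContinuousLinearEquiv.unitsEquivAut ℝ
      (Units.mk0 (2 * Real.pi)⁻¹ (inv_ne_zero Real.two_pi_pos.ne')))
    (𝓕⁻ (f.postcompCLM (RCLike.map 𝕜 ℂ)))

lemma hat_apply (f : 𝓢(ℝ, 𝕜)) (ω : ℝ) :
    hat f ω = ∫ t : ℝ, exp (I * ω * t) * RCLike.map 𝕜 ℂ (f t) := by
  simp only [hat, SchwartzMap.compCLMOfContinuousLinearEquiv_apply, Function.comp_apply,
    SchwartzMap.fourierInv_coe]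
  rw [Real.fourierInv_eq']
  refine integral_congr_ae (Filter.Eventually.of_forall fun t => ?_)
  have hp : (Real.pi : ℂ) ≠ 0 := ofReal_ne_zero.2 Real.pi_ne_zero
  simp only [SchwartzMap.postcompCLM_apply, smul_eq_mul]
  congr 2
  simp
  field_simp

variable (μ : Measure ℝ) [μ.HasTemperateGrowth]

/-- The vector `|f⟩` of the one-particle Hilbert space `L²(ℝ, μ)` given by a test function `f`,
so that `⟨f|g⟩ = ∫ conj (f̂ ω) (ĝ ω) dμ(ω)`. -/
def ket (f : 𝓢(ℝ, 𝕜)) : Lp ℂ 2 μ := (hat f).toLp 2 μ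

lemma inner_ket (f g : 𝓢(ℝ, 𝕜)) :
    ⟪ket μ f, ket μ g⟫_ℂ = ∫ ω, (starRingEnd ℂ) (hat f ω) * hat g ω ∂μ := by
  rw [L2.inner_def]
  refine integral_congr_ae ?_
  filter_upwards [(hat f).coeFn_toLp 2 μ, (hat g).coeFn_toLp 2 μ] with ω h1 h2
  simp only [ket, h1, h2, RCLike.inner_apply]
  ring

variable (𝕜) in
/-- The C*-algebra `B_J` of the time set `J`: the norm closed *-algebra generated by the Weyl
operators `W(f)`, `f` a Schwartz function supported in `J`.  The norm is that of the regular
representation, which is the C*-norm of the Weyl algebra; no state enters. -/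
def bandAlgebra (J : Set ℝ) :
    StarSubalgebra ℂ (RegularSpace (Lp ℂ 2 μ) →L[ℂ] RegularSpace (Lp ℂ 2 μ)) :=
  (StarAlgebra.adjoin ℂ
    {A | ∃ f : 𝓢(ℝ, 𝕜), Function.support f ⊆ J ∧ A = weyl (ket μ f)}).topologicalClosure

variable (𝕜) in
lemma bandAlgebra_mono {J K : Set ℝ} (h : J ⊆ K) : bandAlgebra 𝕜 μ J ≤ bandAlgebra 𝕜 μ K :=
  StarSubalgebra.topologicalClosure_mono (StarAlgebra.adjoin_mono
    fun _ ⟨f, hf, hA⟩ => ⟨f, hf.trans h, hA⟩)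

/-- `W(f)` as an element of the global algebra `B_{(-∞,∞)}`. -/
def fieldWeyl (f : 𝓢(ℝ, 𝕜)) : bandAlgebra 𝕜 μ Set.univ :=
  ⟨weyl (ket μ f), StarSubalgebra.le_topologicalClosure _
    (StarAlgebra.subset_adjoin ℂ _ ⟨f, Set.subset_univ _, rfl⟩)⟩

end TimeBand

/-! ### Time evolution, Hamiltonian, representations -/

section Dynamics

variable {H : Type*} [NormedAddCommGroup H] [InnerProductSpace ℂ H] [CompleteSpace H]

variable (H) in
/-- A strongly continuous one-parameter group of unitaries `U(t) = e^{iHt}`. -/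
structure UnitaryGroup where
  /-- the operators `U(t)` -/
  U : ℝ → H →L[ℂ] H
  unitary : ∀ t, U t ∈ unitary (H →L[ℂ] H)
  zero : U 0 = 1
  add : ∀ s t, U (s + t) = U s * U t
  continuous : ∀ x, Continuous fun t => U t x

/-- The Hamiltonian, i.e. the (Stone) generator of `U(t) = e^{iHt}`: its domain consists of the `x`
for which `t ↦ U(t) x` is differentiable at `0`, and `H x = -i (d/dt) U(t) x` at `t = 0`. -/
def UnitaryGroup.hamiltonian (𝒰 : UnitaryGroup H) : H →ₗ.[ℂ] H where
  domain :=
    { carrier := {x | DifferentiableAt ℝ (fun t => 𝒰.U t x) 0}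
      add_mem' := fun {x y} hx hy => by
        simpa using DifferentiableAt.fun_add (show DifferentiableAt ℝ _ _ from hx) hy
      zero_mem' := by simp
      smul_mem' := fun c x hx => by
        simpa using DifferentiableAt.fun_const_smul (show DifferentiableAt ℝ _ _ from hx) c }
  toFun :=
    { toFun := fun x => -I • deriv (fun t => 𝒰.U t (x : H)) 0
      map_add' := fun x y => by
        have := deriv_fun_add (show DifferentiableAt ℝ (fun t => 𝒰.U t (x : H)) 0 from x.2) y.2
        simp only [Submodule.coe_add, map_add, this, smul_add]
      map_smul' := fun c x => by
        have := deriv_fun_const_smul c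
          (show DifferentiableAt ℝ (fun t => 𝒰.U t (x : H)) 0 from x.2)
        simp only [Submodule.coe_smul, map_smul, this, RingHom.id_apply]
        rw [smul_comm] }

/-- The Hamiltonian is bounded from below. -/
def UnitaryGroup.BoundedBelow (𝒰 : UnitaryGroup H) : Prop :=
  ∃ c : ℝ, ∀ x : 𝒰.hamiltonian.domain, c * ‖(x : H)‖ ^ 2 ≤ (⟪(x : H), 𝒰.hamiltonian x⟫_ℂ).re

/-- `Ψ` is an entire vector: `t ↦ e^{iHt} Ψ` extends to an entire function `ℂ → H`. -/
def UnitaryGroup.IsEntire (𝒰 : UnitaryGroup H) (Ψ : H) : Prop :=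
  ∃ F : ℂ → H, Differentiable ℂ F ∧ ∀ t : ℝ, F t = 𝒰.U t Ψ

/-- A representation on a nonzero Hilbert space is irreducible if no closed subspace other than `0`
and the whole space is invariant. -/
def IsIrreducible {A : Type*} [Semiring A] [Algebra ℂ A] [Star A]
    (π : A →⋆ₐ[ℂ] (H →L[ℂ] H)) : Prop :=
  Nontrivial H ∧ ∀ K : Submodule ℂ H, IsClosed (K : Set H) →
    (∀ a : A, ∀ x ∈ K, π a x ∈ K) → K = ⊥ ∨ K = ⊤

end Dynamics

end GFF

end

/-!
Let `χ` be orthogonal to `π(𝓑_I) Ψ`, and let `Z` be the set of all test functions `f` with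
`⟨χ, π(W(f)) Ψ⟩ = 0`.  It is closed by the continuity of the field, and it contains the test
functions supported in `I`.  The aim is `Z = 𝓢(ℝ)`: then `χ` is orthogonal to the closed span of the
vectors `π(W(f)) Ψ`, which is a nonzero invariant subspace, hence all of the Hilbert space by
irreducibility (`eq_zero_of_inner_orbit_eq_zero`, `map_mem_of_generators`), and `χ = 0`.

The energy enters through one property of `Z`: if `g + h(· - s) ∈ Z` for all small `s`, then for all
real `s` (`translationRigid_inner_eq_zero`).  Indeed, up to a phase,
`⟨χ, π(W(g + h(· - s))) Ψ⟩ = ⟨π(W(g))* χ, U(s) π(W(h)) U(-s) Ψ⟩`.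
As `Ψ` is entire and the Hamiltonian is bounded below, the right-hand side continues to the upper
half plane, and there it is determined by its boundary values near `s = 0`
(`eq_zero_of_eq_zero_on_interval`).  The continuation of the orbit of an arbitrary vector
(`UnitaryGroup.BoundedBelow.exists_continuation`) needs no spectral theorem: Gaussian averages over
the group give a dense set of entire vectors `y`, a differential inequality for `‖U(iτ) y‖²` gives
`‖U(z) y‖ ≤ e^{-c Im z} ‖y‖` from `H ≥ c`, and uniform limits give the rest.

This property makes `Z` spread (`TranslationRigid.eq_univ`).  A test function supported in an
interval slightly longer than `(a, b)` is a sum `g + h` with `g` supported in `(a, b)` and `h`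
supported in a short interval around an end point.  A translate `h'` of `h` has its support well
inside `(a, b)`, so `g + h'(· - s)` is supported in `(a, b)` for small `s`, and the property yields
`g + h ∈ Z`.  Repeating this step reaches all bounded supports, and these are dense in the Schwartz
space.  Working with the sums `g + h` in place of products of Weyl operators avoids functions of
several complex variables.
-/

noncomputable section

open Filter Topology

namespace GFF

/-! ### Entire vectors and the analytic continuation of the time evolution -/

section Continuation

lemma norm_gaussian_le {n R : ℝ} (hn : 0 < n) {z : ℂ} (hz : ‖z‖ ≤ R) (s : ℝ) :
    ‖cexp (-(n : ℂ) * (s - z) ^ 2)‖ ≤ Real.exp (n * R ^ 2) * Real.exp (-(n / 2) * s ^ 2) := by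
  have h1 : (-(n : ℂ) * (s - z) ^ 2).re = -n * ((s - z.re) ^ 2 - z.im ^ 2) := by
    simp [pow_two]
  have h2 : z.re ^ 2 + z.im ^ 2 ≤ R ^ 2 := by
    have := pow_le_pow_left₀ (norm_nonneg z) hz 2
    rw [← Complex.normSq_eq_norm_sq, Complex.normSq_apply] at this
    linarith
  rw [Complex.norm_exp, ← Real.exp_add, h1]
  refine Real.exp_le_exp.2 ?_
  nlinarith [mul_nonneg hn.le (sq_nonneg (s - 2 * z.re)), mul_le_mul_of_nonneg_left h2 hn.le]

variable {H : Type*} [NormedAddCommGroup H] [InnerProductSpace ℂ H] [CompleteSpace H]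

namespace UnitaryGroup

variable (𝒰 : UnitaryGroup H)

lemma norm_map (t : ℝ) (x : H) : ‖𝒰.U t x‖ = ‖x‖ :=
  ContinuousLinearMap.norm_map_of_mem_unitary (𝒰.unitary t) x

lemma add_apply (s t : ℝ) (x : H) : 𝒰.U (s + t) x = 𝒰.U s (𝒰.U t x) := by
  rw [𝒰.add]; rfl

lemma inner_map_right (t : ℝ) (x y : H) : ⟪x, 𝒰.U t y⟫_ℂ = ⟪𝒰.U (-t) x, y⟫_ℂ := by
  have h := ContinuousLinearMap.inner_map_map_of_mem_unitary (𝒰.unitary t) (𝒰.U (-t) x) y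
  rw [← h, ← 𝒰.add_apply, add_neg_cancel, 𝒰.zero]
  rfl

/-- The (unnormalised) Gaussian average `∫ e^{-n (s - z)²} U(s) x ds`.  It continues
`U(z) ∫ e^{-n s²} U(s) x ds` to complex times `z`. -/
def gaussianMean (n : ℝ) (x : H) (z : ℂ) : H :=
  ∫ s : ℝ, cexp (-(n : ℂ) * (s - z) ^ 2) • 𝒰.U s x

lemma integrable_gaussian_smul {n : ℝ} (hn : 0 < n) (x : H) (z : ℂ) :
    Integrable fun s : ℝ => cexp (-(n : ℂ) * (s - z) ^ 2) • 𝒰.U s x := by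
  refine Integrable.mono'
    ((((integrable_exp_neg_mul_sq (half_pos hn)).const_mul (Real.exp (n * ‖z‖ ^ 2))).mul_const ‖x‖))
    ?_ (Eventually.of_forall fun s => ?_)
  · have := 𝒰.continuous x
    exact (by fun_prop : Continuous _).aestronglyMeasurable
  · rw [norm_smul, norm_map]
    exact mul_le_mul_of_nonneg_right (norm_gaussian_le hn le_rfl s) (norm_nonneg _)

lemma differentiable_gaussianMean {n : ℝ} (hn : 0 < n) (x : H) :
    Differentiable ℂ (𝒰.gaussianMean n x) := by
  intro z₀
  have hU := 𝒰.continuous x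
  set R : ℝ := ‖z₀‖ + 1
  have hb : Integrable fun s : ℝ =>
      2 * n * (|s| + R) * (Real.exp (n * R ^ 2) * Real.exp (-(n / 2) * s ^ 2)) * ‖x‖ := by
    have h1 := (integrable_mul_exp_neg_mul_sq (half_pos hn)).norm
    have h2 := integrable_exp_neg_mul_sq (half_pos hn)
    refine ((((h1.add (h2.const_mul R)).const_mul (2 * n * Real.exp (n * R ^ 2))).mul_const
      ‖x‖)).congr (Eventually.of_forall fun s => ?_)
    simp only [Pi.add_apply, Real.norm_eq_abs, abs_mul, Real.abs_exp]
    ring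
  refine (hasDerivAt_integral_of_dominated_loc_of_deriv_le
    (F := fun z (s : ℝ) => cexp (-(n : ℂ) * (s - z) ^ 2) • 𝒰.U s x)
    (F' := fun z (s : ℝ) => (cexp (-(n : ℂ) * (s - z) ^ 2) * (2 * n * (s - z))) • 𝒰.U s x)
    (Metric.ball_mem_nhds z₀ one_pos)
    (Eventually.of_forall fun z => (𝒰.integrable_gaussian_smul hn x z).aestronglyMeasurable)
    (𝒰.integrable_gaussian_smul hn x z₀)
    (by fun_prop : Continuous _).aestronglyMeasurable
    (Eventually.of_forall fun s z hz => ?_) hb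
    (Eventually.of_forall fun s z _ => ?_)).2.differentiableAt
  · have hzR : ‖z‖ ≤ R := by
      have h1 : ‖z - z₀‖ < 1 := by simpa [dist_eq_norm] using hz
      have h2 := norm_le_insert' z z₀
      linarith
    have h3 : ‖(2 * n * (s - z) : ℂ)‖ ≤ 2 * n * (|s| + R) := by
      have h4 : ‖(s - z : ℂ)‖ ≤ |s| + R := (norm_sub_le _ _).trans (by simpa using hzR)
      simpa [abs_of_pos hn] using mul_le_mul_of_nonneg_left h4 (by positivity : 0 ≤ 2 * n)
    rw [norm_smul, norm_mul, norm_map, mul_comm ‖cexp _‖]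
    have := norm_gaussian_le hn hzR s
    gcongr
  · have h1 : HasDerivAt (fun z : ℂ => -(n : ℂ) * (s - z) ^ 2) (2 * n * (s - z)) z := by
      have := (((hasDerivAt_id z).const_sub (s : ℂ)).pow 2).const_mul (-(n : ℂ))
      convert! this using 1
      simp
      ring
    exact h1.cexp.smul_const _

lemma map_gaussianMean {n : ℝ} (hn : 0 < n) (x : H) (t : ℝ) (z : ℂ) :
    𝒰.U t (𝒰.gaussianMean n x z) = 𝒰.gaussianMean n x (z + t) := by
  rw [gaussianMean, ← (𝒰.U t).integral_comp_comm (𝒰.integrable_gaussian_smul hn x z),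
    ← integral_sub_right_eq_self _ t, gaussianMean]
  refine integral_congr_ae (Eventually.of_forall fun s => ?_)
  simp only [map_smul, ← 𝒰.add_apply, add_sub_cancel]
  congr 3
  push_cast
  ring

/-- Normalised Gaussian averages with shrinking width: orbits of entire vectors approximating `x`. -/
lemma exists_entire_approx (x : H) :
    ∃ F : ℕ → ℂ → H, (∀ k, Differentiable ℂ (F k)) ∧
      (∀ k (t : ℝ) z, 𝒰.U t (F k z) = F k (z + t)) ∧ Tendsto (fun k => F k 0) atTop (𝓝 x) := by
  have hpos : ∀ k : ℕ, (0 : ℝ) < (k + 1 : ℝ) := fun k => by positivity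
  refine ⟨fun k z => (((k + 1 : ℝ) / √Real.pi : ℝ) : ℂ) • 𝒰.gaussianMean ((k + 1 : ℝ) ^ 2) x z,
    fun k => (𝒰.differentiable_gaussianMean (pow_pos (hpos k) 2) x).const_smul _,
    fun k t z => by rw [map_smul, 𝒰.map_gaussianMean (pow_pos (hpos k) 2)], ?_⟩
  have hπ : (√Real.pi : ℝ) ≠ 0 := (Real.sqrt_pos.2 Real.pi_pos).ne'
  have key : ∀ k : ℕ,
      (((k + 1 : ℝ) / √Real.pi : ℝ) : ℂ) • 𝒰.gaussianMean ((k + 1 : ℝ) ^ 2) x 0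
        = (√Real.pi)⁻¹ • ∫ s : ℝ, Real.exp (-1 * s ^ 2) • 𝒰.U (s / (k + 1 : ℝ)) x := by
    intro k
    have h := Measure.integral_comp_mul_left
      (fun s : ℝ => Real.exp (-1 * s ^ 2) • 𝒰.U (s / (k + 1 : ℝ)) x) (k + 1 : ℝ)
    have h2 : 𝒰.gaussianMean ((k + 1 : ℝ) ^ 2) x 0
        = |(k + 1 : ℝ)⁻¹| • ∫ s : ℝ, Real.exp (-1 * s ^ 2) • 𝒰.U (s / (k + 1 : ℝ)) x := by
      rw [← h, gaussianMean]
      refine integral_congr_ae (Eventually.of_forall fun s => ?_)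
      simp only
      rw [mul_div_cancel_left₀ _ (hpos k).ne', ← Complex.coe_smul]
      congr 1
      push_cast
      congr 1
      ring
    rw [h2, abs_of_pos (inv_pos.2 (hpos k)), Complex.coe_smul, smul_smul]
    congr 1
    field_simp [(hpos k).ne']
  simp only [key]
  have hlim : Tendsto (fun k : ℕ => ∫ s : ℝ, Real.exp (-1 * s ^ 2) • 𝒰.U (s / (k + 1 : ℝ)) x) atTop
      (𝓝 (∫ s : ℝ, Real.exp (-1 * s ^ 2) • x)) := by
    refine tendsto_integral_filter_of_dominated_convergence
      (fun s => Real.exp (-1 * s ^ 2) * ‖x‖) (Eventually.of_forall fun k => ?_)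
      (Eventually.of_forall fun k => Eventually.of_forall fun s => ?_)
      ((integrable_exp_neg_mul_sq one_pos).mul_const _) (Eventually.of_forall fun s => ?_)
    · have := (𝒰.continuous x).comp (continuous_id.div_const (k + 1 : ℝ))
      exact (Continuous.smul (by fun_prop : Continuous fun s : ℝ => Real.exp (-1 * s ^ 2))
        this).aestronglyMeasurable
    · rw [norm_smul, norm_map, Real.norm_of_nonneg (Real.exp_pos _).le]
    · have h0 : Tendsto (fun k : ℕ => s / (k + 1 : ℝ)) atTop (𝓝 0) :=
        (tendsto_const_nhds (x := s)).div_atTop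
          (tendsto_atTop_add_const_right _ _ tendsto_natCast_atTop_atTop)
      have h1 := ((𝒰.continuous x).tendsto 0).comp h0
      rw [𝒰.zero] at h1
      exact h1.const_smul _
  have := hlim.const_smul (√Real.pi)⁻¹
  rwa [integral_smul_const, integral_gaussian, div_one, smul_smul, inv_mul_cancel₀ hπ,
    one_smul] at this

/-- If `H ≥ c` then `‖U(z) y‖ ≤ e^{-c Im z} ‖y‖` in the upper half plane for an entire vector `y`:
with `y(τ) = U(iτ) y` one has `d/dτ ‖y(τ)‖² = -2 ⟨y(τ), H y(τ)⟩ ≤ -2 c ‖y(τ)‖²`. -/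
lemma norm_le_exp_of_entire {c : ℝ}
    (hc : ∀ x : 𝒰.hamiltonian.domain, c * ‖(x : H)‖ ^ 2 ≤ (⟪(x : H), 𝒰.hamiltonian x⟫_ℂ).re)
    {F : ℂ → H} (hF : Differentiable ℂ F) (hU : ∀ (t : ℝ) z, 𝒰.U t (F z) = F (z + t))
    {z : ℂ} (hz : 0 ≤ z.im) : ‖F z‖ ≤ Real.exp (-(c * z.im)) * ‖F 0‖ := by
  have hH : ∀ w, c * ‖F w‖ ^ 2 ≤ (⟪F w, -I • deriv F w⟫_ℂ).re := by
    intro w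
    have h1 : HasDerivAt (fun t : ℝ => 𝒰.U t (F w)) (deriv F w) 0 := by
      simp only [hU]
      have h2 : HasDerivAt (fun t : ℝ => w + (t : ℂ)) 1 0 :=
        (Complex.ofRealCLM.hasDerivAt).const_add w
      have h3 : HasDerivAt F (deriv F w) (w + ((0 : ℝ) : ℂ)) := by
        simpa using (hF w).hasDerivAt
      have h4 := h3.scomp (0 : ℝ) h2
      rwa [one_smul] at h4
    have h4 := hc ⟨F w, h1.differentiableAt⟩
    rwa [show 𝒰.hamiltonian ⟨F w, h1.differentiableAt⟩
      = -I • deriv (fun t => 𝒰.U t (F w)) 0 from rfl, h1.deriv] at h4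
  let p : ℝ → ℂ := fun τ => (z.re : ℂ) + τ * I
  have hp : ∀ τ : ℝ, HasDerivAt (fun τ => F (p τ)) (I • deriv F (p τ)) τ := by
    intro τ
    have h2 : HasDerivAt p I τ := by
      have := ((Complex.ofRealCLM.hasDerivAt (x := τ)).mul_const I).const_add (z.re : ℂ)
      rwa [Complex.ofRealCLM_apply, Complex.ofReal_one, one_mul] at this
    exact (hF (p τ)).hasDerivAt.scomp τ h2
  let q : ℝ → ℝ := fun τ => Real.exp (2 * c * τ) * ‖F (p τ)‖ ^ 2
  have hq : ∀ τ, HasDerivAt q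
      (Real.exp (2 * c * τ) * (2 * c) * ‖F (p τ)‖ ^ 2
        + Real.exp (2 * c * τ) * (-2 * (⟪F (p τ), -I • deriv F (p τ)⟫_ℂ).re)) τ := by
    intro τ
    have h1 : HasDerivAt (fun τ => ‖F (p τ)‖ ^ 2)
        (-2 * (⟪F (p τ), -I • deriv F (p τ)⟫_ℂ).re) τ := by
      have h2 := Complex.reCLM.hasFDerivAt.comp_hasDerivAt τ ((hp τ).inner ℂ (hp τ))
      have h3 : Complex.reCLM ∘ (fun t => ⟪F (p t), F (p t)⟫_ℂ) = fun τ => ‖F (p τ)‖ ^ 2 := by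
        funext t
        simp [inner_self_eq_norm_sq_to_K, ← Complex.ofReal_pow]
      rw [h3] at h2
      convert! h2 using 1
      have h4 : (⟪I • deriv F (p τ), F (p τ)⟫_ℂ).re = (⟪F (p τ), I • deriv F (p τ)⟫_ℂ).re :=
        inner_re_symm (𝕜 := ℂ) _ _
      simp only [Complex.reCLM_apply, Complex.add_re, h4, neg_smul, inner_neg_right, Complex.neg_re]
      ring
    have h2 : HasDerivAt (fun τ => Real.exp (2 * c * τ)) (Real.exp (2 * c * τ) * (2 * c)) τ := by
      simpa using ((hasDerivAt_id τ).const_mul (2 * c)).exp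
    exact h2.mul h1
  have hanti : Antitone q := by
    refine antitone_of_deriv_nonpos (fun τ => (hq τ).differentiableAt) fun τ => ?_
    rw [(hq τ).deriv]
    nlinarith [Real.exp_pos (2 * c * τ), hH (p τ)]
  have h1 := hanti hz
  have h0 : ‖F (p 0)‖ = ‖F 0‖ := by
    have := hU z.re 0
    simp only [p, Complex.ofReal_zero, zero_mul, add_zero]
    rw [zero_add] at this
    rw [← this, norm_map]
  have hz' : p z.im = z := Complex.re_add_im z
  simp only [q, h0, hz', mul_zero, Real.exp_zero, one_mul] at h1
  have h2 : (Real.exp (c * z.im) * ‖F z‖) ^ 2 ≤ ‖F 0‖ ^ 2 := by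
    rw [mul_pow, ← Real.exp_nat_mul]
    rwa [show ((2 : ℕ) : ℝ) * (c * z.im) = 2 * c * z.im by push_cast; ring]
  have h3 := (abs_le_of_sq_le_sq' h2 (norm_nonneg _)).2
  rw [Real.exp_neg, ← div_eq_inv_mul, le_div_iff₀ (Real.exp_pos _)]
  linarith

/-- When the Hamiltonian is bounded from below, every orbit `t ↦ U(t) x` is the boundary value of a
function that is holomorphic in the upper half plane and continuous up to the real axis. -/
lemma BoundedBelow.exists_continuation {𝒰 : UnitaryGroup H} (hb : 𝒰.BoundedBelow) (x : H) :
    ∃ G : ℂ → H, ContinuousOn G {z | 0 ≤ z.im} ∧ DifferentiableOn ℂ G {z | 0 < z.im} ∧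
      ∀ s : ℝ, G s = 𝒰.U s x := by
  obtain ⟨c, hc⟩ := hb
  obtain ⟨F, hF, hU, hlim⟩ := 𝒰.exists_entire_approx x
  -- the factor `e^{-icz}` compensates the growth `e^{-c Im z}`, so that the convergence is uniform
  let E : ℕ → ℂ → H := fun k z => cexp (-I * c * z) • F k z
  have hE : ∀ k, Differentiable ℂ (E k) := fun k =>
    (by fun_prop : Differentiable ℂ fun z : ℂ => cexp (-I * c * z)).smul (hF k)
  have hEd : ∀ k l z, 0 ≤ z.im → ‖E k z - E l z‖ ≤ ‖F k 0 - F l 0‖ := by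
    intro k l z hz
    have h1 := 𝒰.norm_le_exp_of_entire hc (F := fun w => F k w - F l w) ((hF k).sub (hF l))
      (fun t w => by rw [map_sub, hU, hU]) hz
    have h2 : ‖cexp (-I * c * z)‖ = Real.exp (c * z.im) := by
      rw [Complex.norm_exp]; simp
    rw [← smul_sub, norm_smul, h2]
    calc Real.exp (c * z.im) * ‖F k z - F l z‖
        ≤ Real.exp (c * z.im) * (Real.exp (-(c * z.im)) * ‖F k 0 - F l 0‖) := by gcongr
      _ = ‖F k 0 - F l 0‖ := by rw [← mul_assoc, ← Real.exp_add, add_neg_cancel, Real.exp_zero,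
          one_mul]
  have hcau : UniformCauchySeqOn E atTop {z : ℂ | 0 ≤ z.im} := by
    rw [Metric.uniformCauchySeqOn_iff]
    intro ε hε
    obtain ⟨N, hN⟩ := Metric.cauchySeq_iff.1 hlim.cauchySeq ε hε
    refine ⟨N, fun m hm n hn z hz => ?_⟩
    have := hN m hm n hn
    rw [dist_eq_norm] at this ⊢
    exact (hEd m n z hz).trans_lt this
  have hex : ∀ z : ℂ, ∃ y, 0 ≤ z.im → Tendsto (fun k => E k z) atTop (𝓝 y) := by
    intro z
    by_cases hz : 0 ≤ z.im
    · obtain ⟨y, hy⟩ := cauchySeq_tendsto_of_complete (hcau.cauchySeq hz)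
      exact ⟨y, fun _ => hy⟩
    · exact ⟨0, fun h => absurd h hz⟩
  choose G hG using hex
  have hunif : TendstoUniformlyOn E G atTop {z : ℂ | 0 ≤ z.im} :=
    hcau.tendstoUniformlyOn_of_tendsto fun z hz => hG z hz
  have hexp : Differentiable ℂ fun z : ℂ => cexp (I * c * z) := by fun_prop
  refine ⟨fun z => cexp (I * c * z) • G z, ?_, ?_, fun s => ?_⟩
  · exact hexp.continuous.continuousOn.smul
      (hunif.continuousOn (Eventually.of_forall fun k => (hE k).continuous.continuousOn).frequently)
  · have hloc : TendstoLocallyUniformlyOn E G atTop {z : ℂ | 0 < z.im} :=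
      (hunif.mono fun z (hz : 0 < z.im) => hz.le).tendstoLocallyUniformlyOn
    exact hexp.differentiableOn.smul
      (hloc.differentiableOn (Eventually.of_forall fun k => (hE k).differentiableOn)
        (isOpen_lt continuous_const Complex.continuous_im))
  · have h1 := hG s (by simp)
    have h2 : Tendsto (fun k => E k s) atTop (𝓝 (cexp (-I * c * s) • 𝒰.U s x)) := by
      have h3 : ∀ k, F k s = 𝒰.U s (F k 0) := fun k => by rw [hU, zero_add]
      simp only [E, h3]
      exact (((𝒰.U s).continuous.tendsto x).comp hlim).const_smul _
    simp only
    rw [tendsto_nhds_unique h1 h2, smul_smul, ← Complex.exp_add]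
    simp

end UnitaryGroup

end Continuation

/-! ### Uniqueness from boundary values on an interval -/

section Uniqueness

/-- If `h` vanishes on the bottom side of a square, then it vanishes at the centre: the product of
`h` with its three rotates about the centre vanishes on all four sides. -/
lemma eq_zero_center_of_eq_zero_side {h : ℂ → ℂ} (hc : ContinuousOn h {z | 0 ≤ z.im})
    (hd : DifferentiableOn ℂ h {z | 0 < z.im}) {η : ℝ} (hη : 0 < η)
    (h0 : ∀ s : ℝ, |s| ≤ η → h s = 0) : h (η * I) = 0 := by
  let Q : Set ℂ := Set.Ioo (-η) η ×ℂ Set.Ioo 0 (2 * η)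
  let K : Set ℂ := Set.Icc (-η) η ×ℂ Set.Icc 0 (2 * η)
  have hQcl : closure Q = K := by
    rw [closure_reProdIm, closure_Ioo (by linarith), closure_Ioo (by linarith)]
  have hQo : IsOpen Q := isOpen_Ioo.reProdIm isOpen_Ioo
  let r : ℂ → ℂ := fun z => I * z + (η * I + η)
  have hrre : ∀ z, (r z).re = η - z.im := fun z => by simp [r]; ring
  have hrim : ∀ z, (r z).im = z.re + η := fun z => by simp [r]
  have hr : Differentiable ℂ r := by fun_prop
  have hrQ : Set.MapsTo r Q Q := fun z hz => by
    obtain ⟨⟨h1, h2⟩, h3, h4⟩ := hz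
    refine ⟨⟨?_, ?_⟩, ?_, ?_⟩ <;> simp only [hrre, hrim] <;> linarith
  have hrK : Set.MapsTo r K K := fun z hz => by
    obtain ⟨⟨h1, h2⟩, h3, h4⟩ := hz
    refine ⟨⟨?_, ?_⟩, ?_, ?_⟩ <;> simp only [hrre, hrim] <;> linarith
  have hh : DiffContOnCl ℂ h Q :=
    ⟨hd.mono fun z hz => hz.2.1, by rw [hQcl]; exact hc.mono fun z hz => hz.2.1⟩
  have hcomp : ∀ {g : ℂ → ℂ}, DiffContOnCl ℂ g Q → DiffContOnCl ℂ (g ∘ r) Q := fun {g} hg =>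
    hg.comp hr.diffContOnCl hrQ
  have hprod : DiffContOnCl ℂ (fun z => h z * h (r z) * (h (r (r z)) * h (r (r (r z))))) Q := by
    have e1 := hcomp hh
    have e2 := hcomp e1
    have e3 := hcomp e2
    exact ⟨(hh.1.mul e1.1).mul (e2.1.mul e3.1), (hh.2.mul e1.2).mul (e2.2.mul e3.2)⟩
  have hbot : ∀ z ∈ K, z.im = 0 → h z = 0 := fun z hz hz0 => by
    have hzr : z = ((z.re : ℝ) : ℂ) := Complex.ext rfl (by simpa using hz0)
    rw [hzr]
    exact h0 _ (abs_le.2 hz.1)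
  have hfr : Set.EqOn (fun z => h z * h (r z) * (h (r (r z)) * h (r (r (r z))))) (fun _ => 0)
      (frontier Q) := by
    intro z hz
    rw [frontier, hQcl, hQo.interior_eq] at hz
    obtain ⟨hzK, hzQ⟩ := hz
    have k1 := hrK hzK
    have k2 := hrK k1
    have k3 := hrK k2
    have : z.im = 0 ∨ (r z).im = 0 ∨ (r (r z)).im = 0 ∨ (r (r (r z))).im = 0 := by
      by_contra! hcon
      obtain ⟨n0, n1, n2, n3⟩ := hcon
      simp only [hrim, hrre] at n1 n2 n3
      obtain ⟨⟨a1, a2⟩, a3, a4⟩ := hzK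
      refine hzQ ⟨⟨lt_of_le_of_ne a1 fun e => n1 (by linarith),
        lt_of_le_of_ne a2 fun e => n3 (by linarith)⟩, lt_of_le_of_ne a3 (Ne.symm n0),
        lt_of_le_of_ne a4 fun e => n2 (by linarith)⟩
    rcases this with e | e | e | e
    · simp [hbot _ hzK e]
    · simp [hbot _ k1 e]
    · simp [hbot _ k2 e]
    · simp [hbot _ k3 e]
  have hb : Bornology.IsBounded Q := (Metric.isBounded_Ioo _ _).reProdIm (Metric.isBounded_Ioo _ _)
  have hcen : (η * I : ℂ) ∈ Q := by
    refine ⟨⟨?_, ?_⟩, ?_, ?_⟩ <;> simp <;> linarith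
  have hfix : r (η * I) = η * I := by
    apply Complex.ext
    · rw [hrre]; simp
    · rw [hrim]; simp
  have := Complex.eqOn_of_eqOn_frontier hb hprod diffContOnCl_const hfr hcen
  simpa [hfix] using this

/-- A function holomorphic in the upper half plane and continuous up to the real axis is determined
by its boundary values on an interval. -/
lemma eq_zero_of_eq_zero_on_interval {h : ℂ → ℂ} (hc : ContinuousOn h {z | 0 ≤ z.im})
    (hd : DifferentiableOn ℂ h {z | 0 < z.im}) {ε : ℝ} (hε : 0 < ε)
    (h0 : ∀ s : ℝ, |s| < ε → h s = 0) {z : ℂ} (hz : 0 ≤ z.im) : h z = 0 := by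
  have hopen : IsOpen {z : ℂ | 0 < z.im} := isOpen_lt continuous_const Complex.continuous_im
  have han : AnalyticOnNhd ℂ h {z | 0 < z.im} := hd.analyticOnNhd hopen
  have hfreq : ∃ᶠ w in 𝓝[≠] (((ε / 2 : ℝ) : ℂ) * I), h w = 0 := by
    have ht : Tendsto (fun η : ℝ => (η : ℂ) * I) (𝓝[≠] (ε / 2)) (𝓝[≠] (((ε / 2 : ℝ) : ℂ) * I)) := by
      refine tendsto_nhdsWithin_of_tendsto_nhds_of_eventually_within _
        (((by fun_prop : Continuous fun η : ℝ => (η : ℂ) * I).tendsto _).mono_left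
          nhdsWithin_le_nhds) ?_
      filter_upwards [self_mem_nhdsWithin] with η hη heq
      have := mul_right_cancel₀ I_ne_zero heq
      exact hη (by exact_mod_cast this)
    refine ht.frequently (Eventually.frequently ?_)
    filter_upwards [nhdsWithin_le_nhds (Ioo_mem_nhds (half_pos hε) (half_lt_self hε))] with η hη
    exact eq_zero_center_of_eq_zero_side hc hd hη.1 fun s hs => h0 s (hs.trans_lt hη.2)
  have hEq : Set.EqOn h 0 {z | 0 < z.im} :=
    han.eqOn_zero_of_preconnected_of_frequently_eq_zero
      (convex_halfSpace_im_gt 0).isPreconnected (by simpa using hε) hfreq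
  refine hEq.of_subset_closure hc continuousOn_const (fun w (hw : 0 < w.im) => hw.le) ?_ hz
  rw [Complex.closure_setOfPred_lt_im]

end Uniqueness

/-! ### Cutting off and translating test functions -/

section TestFunctions

variable {𝕜 : Type*} [RCLike 𝕜]

lemma hasTemperateGrowth_contDiffBump {c : ℝ} (φ : ContDiffBump c) :
    Function.HasTemperateGrowth (φ : ℝ → ℝ) :=
  (φ.hasCompactSupport.toSchwartzMap φ.contDiff).hasTemperateGrowth

/-- A test function splits into one that vanishes on `[p, q]` and one supported near `[p, q]`. -/
lemma exists_add_of_Icc (f : 𝓢(ℝ, 𝕜)) {p q δ : ℝ} (hpq : p < q) (hδ : 0 < δ) :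
    ∃ g h : 𝓢(ℝ, 𝕜), f = g + h ∧ Function.support g ⊆ Function.support f \ Set.Icc p q ∧
      Function.support h ⊆ Function.support f ∩ Set.Ioo (p - δ) (q + δ) := by
  let φ : ContDiffBump ((p + q) / 2) := ⟨(q - p) / 2, (q - p) / 2 + δ, by linarith, by linarith⟩
  have hφ := hasTemperateGrowth_contDiffBump φ
  let h : 𝓢(ℝ, 𝕜) := SchwartzMap.smulLeftCLM 𝕜 (φ : ℝ → ℝ) f
  have hh : ∀ t, h t = φ t • f t := SchwartzMap.smulLeftCLM_apply_apply hφ f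
  refine ⟨f - h, h, (sub_add_cancel f h).symm, fun t ht => ?_, fun t ht => ?_⟩
  · rw [Function.mem_support, sub_apply, hh] at ht
    refine ⟨fun hf => ht (by simp [hf]), fun htI => ht ?_⟩
    rw [φ.one_of_mem_closedBall, one_smul, sub_self]
    rw [Real.closedBall_eq_Icc]
    exact ⟨by simp only [φ]; linarith [htI.1], by simp only [φ]; linarith [htI.2]⟩
  · rw [Function.mem_support, hh] at ht
    refine ⟨fun hf => ht (by simp [hf]), ?_⟩
    have h1 : t ∈ Function.support φ := fun h0 => ht (by simp [h0])
    rw [φ.support_eq, Real.ball_eq_Ioo] at h1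
    exact ⟨by have := h1.1; simp only [φ] at this; linarith,
      by have := h1.2; simp only [φ] at this; linarith⟩

/-- Test functions with bounded support are sequentially dense in the Schwartz space. -/
lemma exists_tendsto_bounded_support (f : 𝓢(ℝ, 𝕜)) :
    ∃ u : ℕ → 𝓢(ℝ, 𝕜), Tendsto u atTop (𝓝 f) ∧
      ∀ n : ℕ, Function.support (u n) ⊆ Set.Ioo (-(2 * (n + 1 : ℝ))) (2 * (n + 1 : ℝ)) := by
  let φ : ContDiffBump (0 : ℝ) := ⟨1, 2, one_pos, one_lt_two⟩
  let T : 𝓢(ℝ, ℝ) := φ.hasCompactSupport.toSchwartzMap φ.contDiff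
  have hT : ∀ t, T t = φ t := fun t => rfl
  have hpos : ∀ n : ℕ, (0 : ℝ) < n + 1 := fun n => by positivity
  let θ : ℕ → ℝ → ℝ := fun n t => T ((n + 1 : ℝ)⁻¹ * t)
  have hθ : ∀ n, (θ n).HasTemperateGrowth := fun n => by
    have h1 : Function.HasTemperateGrowth fun t : ℝ => (n + 1 : ℝ)⁻¹ * t :=
      (Function.HasTemperateGrowth.const _).mul Function.HasTemperateGrowth.id'
    exact T.hasTemperateGrowth.comp h1
  let u : ℕ → 𝓢(ℝ, 𝕜) := fun n => SchwartzMap.smulLeftCLM 𝕜 (θ n) f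
  have hu : ∀ n t, u n t = θ n t • f t := fun n => SchwartzMap.smulLeftCLM_apply_apply (hθ n) f
  refine ⟨u, ?_, fun n t ht => ?_⟩
  swap
  · rw [Function.mem_support, hu] at ht
    have h1 : (n + 1 : ℝ)⁻¹ * t ∈ Function.support φ := fun h0 => ht (by simp [θ, hT, h0])
    rw [φ.support_eq, mem_ball_zero_iff, norm_mul, norm_inv, Real.norm_of_nonneg (hpos n).le,
      inv_mul_lt_iff₀ (hpos n), Real.norm_eq_abs] at h1
    have h2 : |t| < 2 * (n + 1 : ℝ) := by
      simp only [φ] at h1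
      linarith
    exact abs_lt.1 h2
  rw [(schwartz_withSeminorms ℝ ℝ 𝕜).tendsto_nhds u f]
  rintro ⟨k, m⟩ ε hε
  -- all derivatives of the cutoffs are bounded uniformly in `n`
  have hθb : ∀ n i t, ‖iteratedFDeriv ℝ i (θ n) t‖ ≤ SchwartzMap.seminorm ℝ 0 i T := by
    intro n i t
    rw [norm_iteratedFDeriv_eq_norm_iteratedDeriv]
    simp only [θ]
    rw [iteratedDeriv_comp_const_mul (T.smooth i) (n + 1 : ℝ)⁻¹]
    have h1 := SchwartzMap.le_seminorm' ℝ 0 i T ((n + 1 : ℝ)⁻¹ * t)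
    rw [pow_zero, one_mul] at h1
    rw [norm_mul, norm_pow, norm_inv, Real.norm_of_nonneg (hpos n).le]
    have h2 : ((n + 1 : ℝ)⁻¹) ^ i ≤ 1 :=
      pow_le_one₀ (inv_nonneg.2 (hpos n).le) (inv_le_one_of_one_le₀ (by simp))
    calc _ ≤ 1 * ‖iteratedDeriv i (⇑T) ((n + 1 : ℝ)⁻¹ * t)‖ := by gcongr
      _ ≤ _ := by rwa [one_mul]
  let C : ℝ := ∑ i ∈ Finset.range (m + 1), (m.choose i : ℝ) * SchwartzMap.seminorm ℝ 0 i T *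
    SchwartzMap.seminorm ℝ (k + 1) (m - i) f + SchwartzMap.seminorm ℝ (k + 1) m f
  have hC : 0 ≤ C := by
    refine add_nonneg (Finset.sum_nonneg fun i _ => ?_) (apply_nonneg _ _)
    exact mul_nonneg (mul_nonneg (Nat.cast_nonneg _) (apply_nonneg _ _)) (apply_nonneg _ _)
  have hbound : ∀ n, SchwartzMap.seminorm ℝ k m (u n - f) ≤ C / (n + 1 : ℝ) := by
    intro n
    refine SchwartzMap.seminorm_le_bound ℝ k m _ (div_nonneg hC (hpos n).le) fun t => ?_
    rcases lt_or_ge |t| (n + 1 : ℝ) with ht | ht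
    · -- the cutoff is `1` near `t`
      have h0 : (⇑(u n - f)) =ᶠ[𝓝 t] fun _ => (0 : 𝕜) := by
        filter_upwards [(continuous_abs.isOpen_preimage _ isOpen_Iio).mem_nhds
          (show t ∈ (fun t : ℝ => |t|) ⁻¹' Set.Iio (n + 1 : ℝ) from ht)] with s hs
        have h1 : θ n s = 1 := by
          refine φ.one_of_mem_closedBall ?_
          rw [mem_closedBall_zero_iff, norm_mul, norm_inv, Real.norm_of_nonneg (hpos n).le,
            inv_mul_le_iff₀ (hpos n), Real.norm_eq_abs]
          simpa [φ] using (le_of_lt hs)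
        rw [sub_apply, hu, h1, one_smul, sub_self]
      rw [(Filter.EventuallyEq.iteratedFDeriv ℝ h0 m).eq_of_nhds]
      have h2 : iteratedFDeriv ℝ m (fun _ : ℝ => (0 : 𝕜)) t = 0 := by
        rw [iteratedFDeriv_fun_zero]; rfl
      rw [h2, norm_zero, mul_zero]
      exact div_nonneg hC (hpos n).le
    · have hk : ∀ (j : ℕ), ‖t‖ ^ k * ‖iteratedFDeriv ℝ j f t‖
          ≤ SchwartzMap.seminorm ℝ (k + 1) j f / (n + 1 : ℝ) := by
        intro j
        rw [le_div_iff₀ (hpos n)]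
        calc ‖t‖ ^ k * ‖iteratedFDeriv ℝ j f t‖ * (n + 1 : ℝ)
            ≤ ‖t‖ ^ k * ‖iteratedFDeriv ℝ j f t‖ * ‖t‖ := by gcongr; exact ht
          _ = ‖t‖ ^ (k + 1) * ‖iteratedFDeriv ℝ j f t‖ := by ring
          _ ≤ _ := SchwartzMap.le_seminorm ℝ (k + 1) j f t
      have h1 : ‖iteratedFDeriv ℝ m (⇑(u n - f)) t‖ ≤
          ∑ i ∈ Finset.range (m + 1), (m.choose i : ℝ) * SchwartzMap.seminorm ℝ 0 i T *
            ‖iteratedFDeriv ℝ (m - i) f t‖ + ‖iteratedFDeriv ℝ m f t‖ := by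
        have e : ⇑(u n - f) = (fun t => θ n t • f t) - ⇑f := by
          funext s
          rw [sub_apply, hu]
          rfl
        have hθs : ContDiff ℝ m (θ n) := ((hθ n).1).of_le (by exact_mod_cast le_top)
        rw [e, iteratedFDeriv_sub_apply (f := fun t => θ n t • f t) (hθs.smul (f.smooth m)).contDiffAt
          (f.smooth m).contDiffAt]
        refine (norm_sub_le _ _).trans (add_le_add_left ?_ _)
        refine (norm_iteratedFDeriv_smul_le hθs (f.smooth m) t le_rfl).trans ?_
        refine Finset.sum_le_sum fun i _ => ?_
        have := hθb n i t
        gcongr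
      calc ‖t‖ ^ k * ‖iteratedFDeriv ℝ m (⇑(u n - f)) t‖
          ≤ ‖t‖ ^ k * (∑ i ∈ Finset.range (m + 1), (m.choose i : ℝ) * SchwartzMap.seminorm ℝ 0 i T *
            ‖iteratedFDeriv ℝ (m - i) f t‖ + ‖iteratedFDeriv ℝ m f t‖) := by gcongr
        _ = ∑ i ∈ Finset.range (m + 1), (m.choose i : ℝ) * SchwartzMap.seminorm ℝ 0 i T *
            (‖t‖ ^ k * ‖iteratedFDeriv ℝ (m - i) f t‖) + ‖t‖ ^ k * ‖iteratedFDeriv ℝ m f t‖ := by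
          rw [mul_add, Finset.mul_sum]
          congr 1
          exact Finset.sum_congr rfl fun i _ => by ring
        _ ≤ ∑ i ∈ Finset.range (m + 1), (m.choose i : ℝ) * SchwartzMap.seminorm ℝ 0 i T *
            (SchwartzMap.seminorm ℝ (k + 1) (m - i) f / (n + 1 : ℝ))
            + SchwartzMap.seminorm ℝ (k + 1) m f / (n + 1 : ℝ) := by
          refine add_le_add (Finset.sum_le_sum fun i _ => ?_) (hk m)
          exact mul_le_mul_of_nonneg_left (hk _)
            (mul_nonneg (Nat.cast_nonneg _) (apply_nonneg _ _))
        _ = C / (n + 1 : ℝ) := by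
          rw [add_div, Finset.sum_div]
          congr 1
          exact Finset.sum_congr rfl fun i _ => by ring
  have hlim : Tendsto (fun n : ℕ => C / (n + 1 : ℝ)) atTop (𝓝 0) :=
    tendsto_const_nhds.div_atTop
      (tendsto_atTop_add_const_right _ _ tendsto_natCast_atTop_atTop)
  filter_upwards [hlim.eventually_lt_const hε] with n hn
  exact (hbound n).trans_lt hn

/-- `Z` cannot tell small translations from large ones: if `Z` contains `g + h(· - s)` for all small
`s`, it does so for all `s`. -/
def TranslationRigid (Z : Set 𝓢(ℝ, 𝕜)) : Prop :=
  ∀ (g h : 𝓢(ℝ, 𝕜)) (ε : ℝ), 0 < ε →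
    (∀ s : ℝ, |s| < ε → g + SchwartzMap.compSubConstCLM 𝕜 s h ∈ Z) →
      ∀ s : ℝ, g + SchwartzMap.compSubConstCLM 𝕜 s h ∈ Z

lemma support_compSubConst_subset {h : 𝓢(ℝ, 𝕜)} {p q : ℝ}
    (hh : Function.support h ⊆ Set.Ioo p q) (s : ℝ) :
    Function.support (SchwartzMap.compSubConstCLM 𝕜 s h) ⊆ Set.Ioo (p + s) (q + s) := fun t ht => by
  have := hh (show t - s ∈ Function.support h from ht)
  exact ⟨by linarith [this.1], by linarith [this.2]⟩

variable {Z : Set 𝓢(ℝ, 𝕜)}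

namespace TranslationRigid

/-- If some translate of `h` has its support well inside `(a, b)`, then `h` may be added to
functions supported in `(a, b)` without leaving `Z`. -/
lemma add_mem (hZ : TranslationRigid Z) {a b : ℝ}
    (hab : ∀ f : 𝓢(ℝ, 𝕜), Function.support f ⊆ Set.Ioo a b → f ∈ Z) {g h : 𝓢(ℝ, 𝕜)}
    (hg : Function.support g ⊆ Set.Ioo a b) {p q r δ : ℝ} (hδ : 0 < δ)
    (hh : Function.support h ⊆ Set.Ioo p q) (hp : a + δ ≤ p + r) (hq : q + r ≤ b - δ) :
    g + h ∈ Z := by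
  have h1 := hZ g (SchwartzMap.compSubConstCLM 𝕜 r h) δ hδ (fun s hs => hab _ ?_) (-r)
  · rwa [SchwartzMap.compSubConstCLM_comp, add_neg_cancel, SchwartzMap.compSubConstCLM_zero] at h1
  · have h2 := support_compSubConst_subset (support_compSubConst_subset hh r) s
    rw [abs_lt] at hs
    refine (Function.support_add _ _).trans (Set.union_subset hg (h2.trans ?_))
    exact Set.Ioo_subset_Ioo (by linarith) (by linarith)

lemma enlarge_right (hZ : TranslationRigid Z) {a b δ : ℝ} (hδ : 0 < δ) (h4 : 4 * δ ≤ b - a)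
    (hab : ∀ f : 𝓢(ℝ, 𝕜), Function.support f ⊆ Set.Ioo a b → f ∈ Z)
    (f : 𝓢(ℝ, 𝕜)) (hf : Function.support f ⊆ Set.Ioo a (b + δ)) : f ∈ Z := by
  obtain ⟨g, h, rfl, hg, hh⟩ := exists_add_of_Icc f (p := b) (q := b + δ) (by linarith) hδ
  refine hZ.add_mem hab (fun t ht => ?_) hδ (p := b - δ) (q := b + δ) (r := -(2 * δ))
    (fun t ht => ?_) (by linarith) (by linarith)
  · obtain ⟨h1, h2⟩ := hg ht
    exact ⟨(hf h1).1, not_le.1 fun h3 => h2 ⟨h3, (hf h1).2.le⟩⟩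
  · exact ⟨(hh ht).2.1, (hf (hh ht).1).2⟩

lemma enlarge_left (hZ : TranslationRigid Z) {a b δ : ℝ} (hδ : 0 < δ) (h4 : 4 * δ ≤ b - a)
    (hab : ∀ f : 𝓢(ℝ, 𝕜), Function.support f ⊆ Set.Ioo a b → f ∈ Z)
    (f : 𝓢(ℝ, 𝕜)) (hf : Function.support f ⊆ Set.Ioo (a - δ) b) : f ∈ Z := by
  obtain ⟨g, h, rfl, hg, hh⟩ := exists_add_of_Icc f (p := a - δ) (q := a) (by linarith) hδ
  refine hZ.add_mem hab (fun t ht => ?_) hδ (p := a - δ) (q := a + δ) (r := 2 * δ)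
    (fun t ht => ?_) (by linarith) (by linarith)
  · obtain ⟨h1, h2⟩ := hg ht
    exact ⟨not_le.1 fun h3 => h2 ⟨(hf h1).1.le, h3⟩, (hf h1).2⟩
  · exact ⟨(hf (hh ht).1).1, (hh ht).2.2⟩

/-- A closed set with the translation property that contains the test functions of one interval
contains all test functions. -/
lemma eq_univ (hZ : TranslationRigid Z) (hcl : IsClosed Z) {a b : ℝ} (hlt : a < b)
    (hab : ∀ f : 𝓢(ℝ, 𝕜), Function.support f ⊆ Set.Ioo a b → f ∈ Z) (f : 𝓢(ℝ, 𝕜)) : f ∈ Z := by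
  set δ : ℝ := (b - a) / 4 with hδ_def
  have hδ : 0 < δ := by rw [hδ_def]; linarith
  have hgrow : ∀ n : ℕ, ∀ f : 𝓢(ℝ, 𝕜),
      Function.support f ⊆ Set.Ioo (a - n * δ) (b + n * δ) → f ∈ Z := by
    intro n
    induction n with
    | zero => simpa using hab
    | succ n ih =>
      have hn : 0 ≤ n * δ := by positivity
      have h1 := hZ.enlarge_right hδ (by linarith) ih
      have h2 := hZ.enlarge_left hδ (by linarith) h1
      intro f hf
      refine h2 f (hf.trans (Set.Ioo_subset_Ioo ?_ ?_)) <;> push_cast <;> linarith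
  obtain ⟨u, hu, hsupp⟩ := exists_tendsto_bounded_support f
  refine hcl.mem_of_tendsto hu (Eventually.of_forall fun n => ?_)
  obtain ⟨N, hN⟩ := exists_nat_ge ((2 * (n + 1 : ℝ) + |a| + |b|) / δ)
  rw [div_le_iff₀ hδ] at hN
  refine hgrow N _ ((hsupp n).trans (Set.Ioo_subset_Ioo ?_ ?_))
  · linarith [le_abs_self a, abs_nonneg b]
  · linarith [neg_abs_le b, abs_nonneg a]

end TranslationRigid

end TestFunctions

/-! ### Translations of a bounded operator on an entire vector -/

section Translation

variable {H : Type*} [NormedAddCommGroup H] [InnerProductSpace ℂ H]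

/-- Reflection makes the antilinear slot of the inner product holomorphic again. -/
lemma hasDerivAt_innerSL_neg_conj {G : ℂ → H} {G' : H} {z : ℂ}
    (hG : HasDerivAt G G' (-(starRingEnd ℂ) z)) :
    HasDerivAt (fun w => innerSL ℂ (G (-(starRingEnd ℂ) w))) (-innerSL ℂ G') z := by
  rw [hasDerivAt_iff_isLittleO] at hG ⊢
  have ht : Tendsto (fun w : ℂ => -(starRingEnd ℂ) w) (𝓝 z) (𝓝 (-(starRingEnd ℂ) z)) :=
    (Complex.continuous_conj.neg).tendsto z
  have h1 := hG.comp_tendsto ht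
  rw [← Asymptotics.isLittleO_norm_norm] at h1 ⊢
  refine h1.congr (fun w => ?_) fun w => ?_
  · have e : innerSL ℂ (G (-(starRingEnd ℂ) w)) - innerSL ℂ (G (-(starRingEnd ℂ) z))
          - (w - z) • -innerSL ℂ G'
        = innerSL ℂ (G (-(starRingEnd ℂ) w) - G (-(starRingEnd ℂ) z)
          - (-(starRingEnd ℂ) w - -(starRingEnd ℂ) z) • G') := by
      ext y
      simp [sub_mul]
      ring
    rw [e, innerSL_apply_norm]
    rfl
  · rw [Function.comp_apply, ← norm_neg, ← Complex.norm_conj]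
    simp [neg_add_eq_sub]

variable [CompleteSpace H]

/-- A matrix element of the translates `U(s) B U(-s)` of a bounded operator, evaluated on an entire
vector, vanishes for all `s` if it does so for small `s`. -/
lemma UnitaryGroup.BoundedBelow.inner_translate_eq_zero {𝒰 : UnitaryGroup H}
    (hb : 𝒰.BoundedBelow) {Ψ : H} (hΨ : 𝒰.IsEntire Ψ) (χ : H) (B : H →L[ℂ] H) {ε : ℝ} (hε : 0 < ε)
    (h0 : ∀ s : ℝ, |s| < ε → ⟪χ, 𝒰.U s (B (𝒰.U (-s) Ψ))⟫_ℂ = 0) (s : ℝ) :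
    ⟪χ, 𝒰.U s (B (𝒰.U (-s) Ψ))⟫_ℂ = 0 := by
  obtain ⟨F, hF, hFU⟩ := hΨ
  obtain ⟨G, hGc, hGd, hGU⟩ := hb.exists_continuation χ
  let h : ℂ → ℂ := fun z => innerSL ℂ (G (-(starRingEnd ℂ) z)) (B (F (-z)))
  have hreal : ∀ s : ℝ, h s = ⟪χ, 𝒰.U s (B (𝒰.U (-s) Ψ))⟫_ℂ := fun s => by
    simp only [h, innerSL_apply_apply, Complex.conj_ofReal]
    rw [← Complex.ofReal_neg, hGU, hFU, 𝒰.inner_map_right]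
  have hBF : Differentiable ℂ fun z => B (F (-z)) :=
    B.differentiable.comp (hF.comp differentiable_neg)
  have hc : ContinuousOn h {z | 0 ≤ z.im} := by
    have h1 : ContinuousOn (fun z => G (-(starRingEnd ℂ) z)) {z : ℂ | 0 ≤ z.im} :=
      hGc.comp (Complex.continuous_conj.neg).continuousOn fun z hz => by simpa using hz
    exact h1.inner (𝕜 := ℂ) hBF.continuous.continuousOn
  have hd : DifferentiableOn ℂ h {z | 0 < z.im} := by
    intro z hz
    have hopen : IsOpen {z : ℂ | 0 < z.im} := isOpen_lt continuous_const Complex.continuous_im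
    have h1 : DifferentiableAt ℂ G (-(starRingEnd ℂ) z) :=
      hGd.differentiableAt (hopen.mem_nhds (by simpa using hz))
    exact ((hasDerivAt_innerSL_neg_conj h1.hasDerivAt).clm_apply
      (hBF z).hasDerivAt).differentiableAt.differentiableWithinAt
  rw [← hreal]
  exact eq_zero_of_eq_zero_on_interval hc hd hε (fun t ht => by rw [hreal, h0 t ht]) (by simp)

end Translation

/-! ### The Weyl relations of the fields -/

section Fields

variable {𝕜 : Type*} [RCLike 𝕜] (μ : Measure ℝ) [μ.HasTemperateGrowth]

lemma hat_add (f g : 𝓢(ℝ, 𝕜)) : hat (f + g) = hat f + hat g := by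
  simp only [hat, map_add, FourierTransform.fourierInv_add]

lemma ket_add (f g : 𝓢(ℝ, 𝕜)) : ket μ (f + g) = ket μ f + ket μ g := by
  simp only [ket, hat_add]
  exact (SchwartzMap.toLpCLM ℂ ℂ 2 μ).map_add (hat f) (hat g)

lemma ket_zero : ket μ (0 : 𝓢(ℝ, 𝕜)) = 0 := by
  simpa using ket_add μ (0 : 𝓢(ℝ, 𝕜)) 0

lemma ket_neg (f : 𝓢(ℝ, 𝕜)) : ket μ (-f) = -ket μ f := by
  rw [eq_neg_iff_add_eq_zero, ← ket_add, neg_add_cancel, ket_zero]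

lemma fieldWeyl_mul (f g : 𝓢(ℝ, 𝕜)) :
    fieldWeyl μ f * fieldWeyl μ g = phase (ket μ f) (ket μ g) • fieldWeyl μ (f + g) := by
  apply Subtype.ext
  change weyl (ket μ f) * weyl (ket μ g) = phase (ket μ f) (ket μ g) • weyl (ket μ (f + g))
  rw [weyl_mul, ket_add]

lemma fieldWeyl_zero : fieldWeyl μ (0 : 𝓢(ℝ, 𝕜)) = 1 := by
  apply Subtype.ext
  change weyl (ket μ (0 : 𝓢(ℝ, 𝕜))) = 1
  rw [ket_zero, weyl_zero]

lemma phase_ne_zero {V : Type*} [NormedAddCommGroup V] [InnerProductSpace ℂ V] (h g : V) :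
    phase h g ≠ 0 :=
  norm_ne_zero_iff.1 (by rw [norm_phase]; exact one_ne_zero)

end Fields

/-! ### Projective representations of the test functions and of C*-algebras -/

section Representation

variable {H : Type*} [NormedAddCommGroup H] [InnerProductSpace ℂ H]

/-- If operators `W(v)`, closed under multiplication up to scalars, act irreducibly, then only `0`
is orthogonal to the orbit of a nonzero vector. -/
lemma eq_zero_of_inner_orbit_eq_zero {V : Type*} [AddMonoid V] {W : V → H →L[ℂ] H} {c : V → V → ℂ}
    (hW : ∀ f g, W f * W g = c f g • W (f + g)) (hW0 : W 0 = 1)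
    (hirr : ∀ K : Submodule ℂ H, IsClosed (K : Set H) → (∀ f, ∀ x ∈ K, W f x ∈ K) →
      K = ⊥ ∨ K = ⊤)
    {Ψ χ : H} (hΨ : Ψ ≠ 0) (hχ : ∀ f, ⟪χ, W f Ψ⟫_ℂ = 0) : χ = 0 := by
  let K₀ : Submodule ℂ H := Submodule.span ℂ (Set.range fun f => W f Ψ)
  let K : Submodule ℂ H := K₀.topologicalClosure
  have hK : IsClosed (K : Set H) := K₀.isClosed_topologicalClosure
  have hmem : ∀ f, W f Ψ ∈ K := fun f =>
    K₀.le_topologicalClosure (Submodule.subset_span ⟨f, rfl⟩)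
  have hinv : ∀ f, ∀ x ∈ K, W f x ∈ K := by
    intro f
    have h0 : K₀ ≤ K.comap (W f : H →ₗ[ℂ] H) := by
      refine Submodule.span_le.2 ?_
      rintro _ ⟨g, rfl⟩
      change (W f * W g) Ψ ∈ K
      rw [hW]
      exact K.smul_mem _ (hmem _)
    exact fun x hx => K₀.topologicalClosure_minimal h0 (hK.preimage (W f).continuous) hx
  have hne : K ≠ ⊥ := fun hbot => hΨ <| by
    have h1 := hmem 0
    rwa [hbot, hW0, Submodule.mem_bot] at h1
  have htop : K = ⊤ := (hirr K hK hinv).resolve_left hne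
  have horth : K₀ ≤ (ℂ ∙ χ)ᗮ := by
    refine Submodule.span_le.2 ?_
    rintro _ ⟨f, rfl⟩
    exact Submodule.mem_orthogonal_singleton_iff_inner_right.2 (hχ f)
  have h1 : χ ∈ (ℂ ∙ χ)ᗮ :=
    K₀.topologicalClosure_minimal horth (Submodule.isClosed_orthogonal _)
      (show χ ∈ K by rw [htop]; trivial)
  exact inner_self_eq_zero.1 (Submodule.mem_orthogonal_singleton_iff_inner_right.1 h1)

variable [CompleteSpace H]

/-- A closed subspace that is invariant under a self-adjoint set of operators is invariant under the
C*-algebra they generate, since a representation of a C*-algebra is norm continuous. -/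
lemma map_mem_of_generators {B : Type*} [CStarAlgebra B] {S : Set B}
    (hS : ∀ s ∈ S, star s ∈ S)
    (π : (StarAlgebra.adjoin ℂ S).topologicalClosure →⋆ₐ[ℂ] (H →L[ℂ] H)) {K : Submodule ℂ H}
    (hK : IsClosed (K : Set H))
    (hinv : ∀ s : (StarAlgebra.adjoin ℂ S).topologicalClosure, (s : B) ∈ S →
      ∀ x ∈ K, π s x ∈ K)
    (a : (StarAlgebra.adjoin ℂ S).topologicalClosure) {x : H} (hx : x ∈ K) : π a x ∈ K := by
  let A := (StarAlgebra.adjoin ℂ S).topologicalClosure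
  let : CStarAlgebra A := StarSubalgebra.cstarAlgebra _
    (h_closed := StarSubalgebra.isClosed_topologicalClosure _)
  have hπ : Continuous π :=
    AddMonoidHomClass.continuous_of_bound π 1 fun a => by
      simpa using NonUnitalStarAlgHom.norm_apply_le π a
  let T : Set A := {a | ∀ x ∈ K, π a x ∈ K}
  have hT : IsClosed T := by
    have : T = ⋂ x ∈ K, (fun a => π a x) ⁻¹' (K : Set H) := by
      ext a; simp [T]
    rw [this]
    exact isClosed_biInter fun x _ =>
      hK.preimage ((ContinuousLinearMap.apply ℂ H x).continuous.comp hπ)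
  have hle : StarAlgebra.adjoin ℂ S ≤ A := StarSubalgebra.le_topologicalClosure _
  have hadj : ∀ b (hb : b ∈ StarAlgebra.adjoin ℂ S), (⟨b, hle hb⟩ : A) ∈ T := by
    intro b hb
    refine Algebra.adjoin_induction (p := fun b hb => (⟨b, hle hb⟩ : A) ∈ T) ?_ ?_ ?_ ?_ hb
    · rintro b (hbS | hbS)
      · exact hinv _ hbS
      · exact hinv _ (by simpa using hS _ hbS)
    · intro c x hx
      have : (⟨algebraMap ℂ B c, hle (algebraMap_mem _ c)⟩ : A) = algebraMap ℂ A c := rfl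
      rw [this, AlgHomClass.commutes]
      exact K.smul_mem c hx
    · intro b b' hb hb' h1 h2 x hx
      have : (⟨b + b', hle (add_mem hb hb')⟩ : A) = ⟨b, hle hb⟩ + ⟨b', hle hb'⟩ := rfl
      rw [this, map_add]
      exact K.add_mem (h1 x hx) (h2 x hx)
    · intro b b' hb hb' h1 h2 x hx
      have : (⟨b * b', hle (mul_mem hb hb')⟩ : A) = ⟨b, hle hb⟩ * ⟨b', hle hb'⟩ := rfl
      rw [this, map_mul]
      exact h1 _ (h2 x hx)
  have hdense : a ∈ closure {b : A | (b : B) ∈ StarAlgebra.adjoin ℂ S} := by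
    rw [closure_subtype]
    have h1 : (a : B) ∈ closure (StarAlgebra.adjoin ℂ S : Set B) := a.2
    refine closure_mono (fun b hb => ?_) h1
    exact ⟨(⟨b, hle hb⟩ : A), hb, rfl⟩
  exact closure_minimal (fun b hb => hadj b.1 hb) hT hdense x hx

/-- A vector is cyclic for an algebra of operators if only `0` is orthogonal to its orbit. -/
lemma closure_range_eq_univ {A : Type*} [Semiring A] [Algebra ℂ A] [Star A]
    (π : A →⋆ₐ[ℂ] (H →L[ℂ] H)) (Ψ : H)
    (h : ∀ χ : H, (∀ a, ⟪χ, π a Ψ⟫_ℂ = 0) → χ = 0) :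
    closure (Set.range fun a => π a Ψ) = Set.univ := by
  let L : A →ₗ[ℂ] H :=
    { toFun := fun a => π a Ψ
      map_add' := fun a b => by rw [map_add]; rfl
      map_smul' := fun c a => by rw [map_smul]; rfl }
  have horth : (LinearMap.range L)ᗮ = ⊥ := by
    rw [Submodule.eq_bot_iff]
    intro χ hχ
    rw [Submodule.mem_orthogonal'] at hχ
    exact h χ fun a => hχ _ ⟨a, rfl⟩
  exact congrArg (fun K : Submodule ℂ H => (K : Set H))
    ((Submodule.topologicalClosure_eq_top_iff (K := LinearMap.range L)).2 horth)

/-- Positivity of the energy: the test functions `f` for which `W(f) Ψ` is orthogonal to a given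
vector form a translation rigid set. -/
lemma translationRigid_inner_eq_zero {𝕜 : Type*} [RCLike 𝕜] {W : 𝓢(ℝ, 𝕜) → H →L[ℂ] H}
    {c : 𝓢(ℝ, 𝕜) → 𝓢(ℝ, 𝕜) → ℂ} (hc : ∀ f g, c f g ≠ 0)
    (hW : ∀ f g, W f * W g = c f g • W (f + g)) {𝒰 : UnitaryGroup H}
    (hcov : ∀ (t : ℝ) (f : 𝓢(ℝ, 𝕜)),
      𝒰.U t * W f * 𝒰.U (-t) = W (SchwartzMap.compSubConstCLM 𝕜 t f))
    (hbdd : 𝒰.BoundedBelow) {Ψ : H} (hent : 𝒰.IsEntire Ψ) (χ : H) :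
    TranslationRigid {f : 𝓢(ℝ, 𝕜) | ⟪χ, W f Ψ⟫_ℂ = 0} := by
  intro g h ε hε hsmall s
  -- up to the scalar of the Weyl relations, `W(g + h(· - s))` is `W(g) U(s) W(h) U(-s)`
  have key : ∀ s : ℝ, ⟪(W g).adjoint χ, 𝒰.U s (W h (𝒰.U (-s) Ψ))⟫_ℂ
      = c g (SchwartzMap.compSubConstCLM 𝕜 s h) *
        ⟪χ, W (g + SchwartzMap.compSubConstCLM 𝕜 s h) Ψ⟫_ℂ := by
    intro s
    have h1 : 𝒰.U s (W h (𝒰.U (-s) Ψ)) = W (SchwartzMap.compSubConstCLM 𝕜 s h) Ψ := by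
      rw [← hcov]; rfl
    rw [h1, ContinuousLinearMap.adjoint_inner_left, ← inner_smul_right]
    exact congrArg (fun A : H →L[ℂ] H => ⟪χ, A Ψ⟫_ℂ) (hW g _)
  have h1 := hbdd.inner_translate_eq_zero hent ((W g).adjoint χ) (W h) hε
    (fun t ht => by rw [key, hsmall t ht, mul_zero]) s
  rw [key] at h1
  exact (mul_eq_zero.1 h1).resolve_left (hc _ _)

end Representation

end GFF

end
/-- Reeh–Schlieder in time. -/
theorem mainTheorem11 {𝕜 : Type*} [RCLike 𝕜]
    (μ : Measure ℝ) [μ.HasTemperateGrowth] (hμ : μ (Set.Iio 0) = 0)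
    {H : Type*} [NormedAddCommGroup H] [InnerProductSpace ℂ H] [CompleteSpace H]
    -- an irreducible representation of the global algebra, with a field depending continuously on
    -- the test function
    (π : GFF.bandAlgebra 𝕜 μ Set.univ →⋆ₐ[ℂ] (H →L[ℂ] H))
    (hirr : GFF.IsIrreducible π)
    (hcont : ∀ x : H, Continuous fun f : 𝓢(ℝ, 𝕜) => π (GFF.fieldWeyl μ f) x)
    -- time translations `e^{iHt} W(f) e^{-iHt} = W(f(· - t))`, the Hamiltonian bounded from below
    (𝒰 : GFF.UnitaryGroup H)
    (hcov : ∀ (t : ℝ) (f : 𝓢(ℝ, 𝕜)),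
      𝒰.U t * π (GFF.fieldWeyl μ f) * 𝒰.U (-t) =
        π (GFF.fieldWeyl μ (SchwartzMap.compSubConstCLM 𝕜 t f)))
    (hbdd : 𝒰.BoundedBelow)
    -- a unit vector which is entire for the time evolution
    (Ψ : H) (hΨ : ‖Ψ‖ = 1) (hent : 𝒰.IsEntire Ψ)
    -- a finite time band
    (a b : ℝ) (hab : a < b) :
    closure (Set.range fun A : GFF.bandAlgebra 𝕜 μ (Set.Ioo a b) =>
      π (StarSubalgebra.inclusion
        (GFF.bandAlgebra_mono 𝕜 μ (Set.subset_univ (Set.Ioo a b))) A) Ψ) = Set.univ := by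
  have hW : ∀ f g : 𝓢(ℝ, 𝕜), π (GFF.fieldWeyl μ f) * π (GFF.fieldWeyl μ g)
      = GFF.phase (GFF.ket μ f) (GFF.ket μ g) • π (GFF.fieldWeyl μ (f + g)) := fun f g => by
    rw [← map_mul, GFF.fieldWeyl_mul, map_smul]
  have hW0 : π (GFF.fieldWeyl μ (0 : 𝓢(ℝ, 𝕜))) = 1 := by rw [GFF.fieldWeyl_zero, map_one]
  have hΨ0 : Ψ ≠ 0 := norm_ne_zero_iff.1 (by rw [hΨ]; exact one_ne_zero)
  have hirr' : ∀ K : Submodule ℂ H, IsClosed (K : Set H) →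
      (∀ f : 𝓢(ℝ, 𝕜), ∀ x ∈ K, π (GFF.fieldWeyl μ f) x ∈ K) → K = ⊥ ∨ K = ⊤ := by
    intro K hK hinv
    refine hirr.2 K hK fun a x hx => GFF.map_mem_of_generators ?_ π hK ?_ a hx
    · rintro _ ⟨f, -, rfl⟩
      exact ⟨-f, Set.subset_univ _, by rw [GFF.ket_neg, GFF.star_weyl]⟩
    · rintro ⟨_, _⟩ ⟨f, -, rfl⟩
      exact hinv f
  refine GFF.closure_range_eq_univ (π.comp (StarSubalgebra.inclusion
    (GFF.bandAlgebra_mono 𝕜 μ (Set.subset_univ (Set.Ioo a b))))) Ψ fun χ hχ => ?_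
  refine GFF.eq_zero_of_inner_orbit_eq_zero hW hW0 hirr' hΨ0 fun f => ?_
  refine (GFF.translationRigid_inner_eq_zero (fun _ _ => GFF.phase_ne_zero _ _) hW hcov hbdd
    hent χ).eq_univ ?_ hab (fun f hf => ?_) f
  · exact isClosed_eq (continuous_const.inner (hcont Ψ)) continuous_const
  · exact hχ ⟨GFF.weyl (GFF.ket μ f), StarSubalgebra.le_topologicalClosure _
      (StarAlgebra.subset_adjoin ℂ _ ⟨f, hf, rfl⟩)⟩
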